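/- Let $\mathbb F$ be an algebraically closed field of characteristic $p>0$ and let $L$ be a finite-dimensional restricted Lie algebra over $\mathbb F$, with $p$-mapping $x\mapsto x^{[p]}$. A restricted subalgebra of $L$ is a Lie subalgebra closed under the $p$-mapping. For restricted subalgebras $U\subseteq V$ of $L$, we say that $U$ is maximal in $V$ if $U\neq V$ and no restricted subalgebra lies strictly between $U$ and $V$; $\langle S,T\rangle_p$ denotes the restricted subalgebra generated by $S\cup T$. Suppose that $L$ is upper semimodular, that is, for all restricted subalgebras $S,T$ of $L$ such that $S\cap T$ is maximal in $T$, the subalgebra $S$ is maximal in $\langle S,T\rangle_p$. Then $L$ is almost abelian or nilpotent. Here $L$ is called almost abelian if $L=\mathbb F x\oplus A$ as a vector space for some nonzero $x\in L$ and some abelian ideal $A$ of $L$ such that $[x,a]=a$ for all $a\in A$. -/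

import Mathlib

/-- `jacobsonCoeff x y n j` is the coefficient of `X ^ j` in `(ad (X x + y)) ^ n (x)`,
an element of `L[X]`; see `ad_pow_eq_sum_jacobsonCoeff`. -/
def jacobsonCoeff {L : Type*} [LieRing L] (x y : L) : ℕ → ℕ → L
  | 0, 0 => x
  | 0, _ + 1 => 0
  | n + 1, 0 => ⁅y, jacobsonCoeff x y n 0⁆
  | n + 1, j + 1 => ⁅y, jacobsonCoeff x y n (j + 1)⁆ + ⁅x, jacobsonCoeff x y n j⁆

theorem jacobsonCoeff_eq_zero {L : Type*} [LieRing L] (x y : L) (n : ℕ) :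
    ∀ j, n < j → jacobsonCoeff x y n j = 0 := by
  induction n with
  | zero =>
    intro j hj
    cases j with
    | zero => omega
    | succ j => rfl
  | succ n ih =>
    intro j hj
    cases j with
    | zero => omega
    | succ j => simp [jacobsonCoeff, ih j (by omega), ih (j + 1) (by omega)]

open scoped TensorProduct in
/-- The generating-function description of `jacobsonCoeff`, in the Lie algebra
`F[X] ⊗ L` over `F[X]`. -/
theorem ad_pow_eq_sum_jacobsonCoeff {F L : Type*} [Field F] [LieRing L] [LieAlgebra F L]
    (x y : L) (n : ℕ) :
    ((LieAlgebra.ad (Polynomial F) (Polynomial F ⊗[F] L)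
        ((Polynomial.X : Polynomial F) ⊗ₜ[F] x + (1 : Polynomial F) ⊗ₜ[F] y)) ^ n)
        ((1 : Polynomial F) ⊗ₜ[F] x) =
      ∑ j ∈ Finset.range (n + 1),
        (Polynomial.X ^ j : Polynomial F) ⊗ₜ[F] jacobsonCoeff x y n j := by
  induction n with
  | zero => simp [jacobsonCoeff]
  | succ n ih =>
    rw [pow_succ', Module.End.mul_apply, ih, LieAlgebra.ad_apply, add_lie, lie_sum, lie_sum]
    simp only [LieAlgebra.ExtendScalars.bracket_tmul, one_mul, ← pow_succ']
    rw [Finset.sum_range_succ' _ (n + 1)]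
    simp only [jacobsonCoeff, TensorProduct.tmul_add, Finset.sum_add_distrib]
    rw [Finset.sum_range_succ' (fun j => (Polynomial.X ^ j : Polynomial F) ⊗ₜ[F]
      ⁅y, jacobsonCoeff x y n j⁆) n]
    rw [Finset.sum_range_succ (fun j => (Polynomial.X ^ (j + 1) : Polynomial F) ⊗ₜ[F]
      ⁅y, jacobsonCoeff x y n (j + 1)⁆) n]
    rw [jacobsonCoeff_eq_zero x y n (n + 1) (by omega)]
    simp only [lie_zero, TensorProduct.tmul_zero, add_zero]
    abel

/-- The elements `s_i(x, y)`, `1 ≤ i ≤ p - 1`, of the sum formula for `p`-mappings, determined by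
`(ad (X x + y)) ^ (p - 1) (x) = ∑ i, i s_i(x, y) X ^ (i - 1)`. -/
def jacobsonS (p : ℕ) (F : Type*) {L : Type*} [Field F] [LieRing L] [LieAlgebra F L]
    (i : ℕ) (x y : L) : L :=
  (i : F)⁻¹ • jacobsonCoeff x y (p - 1) (i - 1)

/-- A restricted Lie algebra structure on a Lie algebra `L` over a field `F` (of prime
characteristic `p`): a `p`-mapping `x ↦ x^{[p]}` in the sense of Jacobson. -/
class RestrictedLieAlgebra (p : ℕ) (F L : Type*) [Field F] [LieRing L] [LieAlgebra F L] where
  pMap : L → L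
  ad_pMap : ∀ x : L, LieAlgebra.ad F L (pMap x) = LieAlgebra.ad F L x ^ p
  pMap_smul : ∀ (a : F) (x : L), pMap (a • x) = a ^ p • pMap x
  pMap_add : ∀ x y : L,
    pMap (x + y) = pMap x + pMap y + ∑ i ∈ Finset.Icc 1 (p - 1), jacobsonS p F i x y

/-- A restricted subalgebra: a Lie subalgebra closed under the `p`-mapping. -/
structure RestrictedLieSubalgebra (p : ℕ) (F L : Type*) [Field F] [LieRing L] [LieAlgebra F L]
    [RestrictedLieAlgebra p F L] extends LieSubalgebra F L where
  pMap_mem' : ∀ x ∈ carrier, RestrictedLieAlgebra.pMap p F x ∈ carrier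

namespace RestrictedLieSubalgebra

variable {p : ℕ} {F L : Type*} [Field F] [LieRing L] [LieAlgebra F L]
  [RestrictedLieAlgebra p F L]

theorem toLieSubalgebra_injective : Function.Injective
    (toLieSubalgebra : RestrictedLieSubalgebra p F L → LieSubalgebra F L) := by
  rintro ⟨S, _⟩ ⟨T, _⟩ h
  cases h
  rfl

instance : SetLike (RestrictedLieSubalgebra p F L) L where
  coe S := (S.toLieSubalgebra : Set L)
  coe_injective _ _ h := toLieSubalgebra_injective (SetLike.coe_injective h)

/-- Restricted subalgebras are ordered by inclusion. -/
instance : PartialOrder (RestrictedLieSubalgebra p F L) :=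
  PartialOrder.ofSetLike (RestrictedLieSubalgebra p F L) L

instance : InfSet (RestrictedLieSubalgebra p F L) where
  sInf 𝒮 :=
    { sInf (toLieSubalgebra '' 𝒮) with
      pMap_mem' := by
        intro x hx
        change x ∈ sInf (toLieSubalgebra '' 𝒮) at hx
        change RestrictedLieAlgebra.pMap p F x ∈ sInf (toLieSubalgebra '' 𝒮)
        rw [← SetLike.mem_coe, LieSubalgebra.coe_sInf, Set.mem_iInter₂] at hx ⊢
        rintro _ ⟨S, hS, rfl⟩
        exact S.pMap_mem' x (hx _ ⟨S, hS, rfl⟩) }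

instance : Min (RestrictedLieSubalgebra p F L) where
  min S T :=
    { S.toLieSubalgebra ⊓ T.toLieSubalgebra with
      pMap_mem' := fun x hx => ⟨S.pMap_mem' x hx.1, T.pMap_mem' x hx.2⟩ }

/-- The restricted subalgebra `⟨s⟩_p` generated by a subset `s` of `L`: the intersection of all
restricted subalgebras that contain `s`. -/
def closure (p : ℕ) (F : Type*) {L : Type*} [Field F] [LieRing L] [LieAlgebra F L]
    [RestrictedLieAlgebra p F L] (s : Set L) : RestrictedLieSubalgebra p F L :=
  sInf {S | s ⊆ S}

theorem mem_sInf {𝒮 : Set (RestrictedLieSubalgebra p F L)} {x : L} :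
    x ∈ sInf 𝒮 ↔ ∀ S ∈ 𝒮, x ∈ S := by
  change x ∈ sInf (toLieSubalgebra '' 𝒮) ↔ _
  rw [← SetLike.mem_coe, LieSubalgebra.coe_sInf, Set.mem_iInter₂, Set.forall_mem_image]
  rfl

theorem mem_inf {S T : RestrictedLieSubalgebra p F L} {x : L} :
    x ∈ S ⊓ T ↔ x ∈ S ∧ x ∈ T :=
  Iff.rfl

/-- `S` is upper semimodular in `L`: `S` is maximal in `⟨S, T⟩_p` for every restricted subalgebra
`T` such that `S ∩ T` is maximal in `T`. Here `U ⋖ V` says that `U < V` and that no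
restricted subalgebra lies strictly between `U` and `V`. -/
def IsUpperSemimodular (S : RestrictedLieSubalgebra p F L) : Prop :=
  ∀ T : RestrictedLieSubalgebra p F L,
    S ⊓ T ⋖ T → S ⋖ closure p F ((S : Set L) ∪ (T : Set L))

end RestrictedLieSubalgebra

/-- `L` is upper semimodular if all its restricted subalgebras are upper semimodular in `L`. -/
def RestrictedLieAlgebra.IsUpperSemimodular (p : ℕ) (F L : Type*) [Field F] [LieRing L]
    [LieAlgebra F L] [RestrictedLieAlgebra p F L] : Prop :=
  ∀ S : RestrictedLieSubalgebra p F L, S.IsUpperSemimodular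

/-- `L` is almost abelian: `L = F x ∔ A` (a direct sum of vector spaces), where `x ≠ 0`, `A` is an
abelian ideal and `ad x` is the identity on `A`. -/
def LieAlgebra.IsAlmostAbelian (F L : Type*) [Field F] [LieRing L] [LieAlgebra F L] : Prop :=
  ∃ (x : L) (A : LieIdeal F L), x ≠ 0 ∧ IsLieAbelian A ∧
    IsCompl (Submodule.span F {x}) (A : Submodule F L) ∧ ∀ a ∈ A, ⁅x, a⁆ = a

/-! Call `t` toral if `t^[p] = t`, and `n` null if `n^[p] = 0`. Both span restricted lines, and
semimodularity makes the line of `x` maximal in `⟨x, y⟩_p` when `x`, `y` span distinct restricted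
lines. A restricted subalgebra containing `x` but not `y` thus meets `⟨x, y⟩_p` only in `Fx`
(`mem_or_forall_mem_line`). Tested on normalizers and centralizers, this makes null elements commute
and be eigenvectors of toral elements, and makes every `e` with `[t, e] = e`, `t` toral, null.

If no toral `t` has a nonzero `e` with `[t, e] = e`, all toral elements are central. A `p`-power
iterate of any `x` lies in a span of toral elements, so `ad x` is nilpotent and Engel's theorem
applies. Otherwise fix such `t` and `e`. Then `ad t` has only the eigenvalues 0 and 1, the
1-eigenspace is the set of null elements, hence abelian, and the 0-eigenspace is `Ft`; so `L` is
almost abelian.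

Toral elements come from Frobenius-semilinear algebra: on a commutative double centralizer the
`p`-mapping is Frobenius-semilinear. -/

/-! ### Frobenius-semilinear endomorphisms. -/

section Semilinear

open Polynomial

variable {F : Type*} [Field F] {p : ℕ} [Fact p.Prime]

/-- The polynomials `P i` for which `∑ i < n, (P i)(c) φ^i v` is fixed by the Frobenius-semilinear
map `φ`, where `φ^n v = ∑ i < n, a i φ^i v` and `c` is a fixed point of `P (n - 1)`. -/
noncomputable def fixedPointPoly (p : ℕ) (a : ℕ → F) : ℕ → F[X]
  | 0 => C (a 0) * X ^ p
  | i + 1 => fixedPointPoly p a i ^ p + C (a (i + 1)) * X ^ p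

theorem X_pow_dvd_fixedPointPoly (a : ℕ → F) (i : ℕ) : X ^ p ∣ fixedPointPoly p a i := by
  have hp : p ≠ 0 := (Fact.out : p.Prime).ne_zero
  induction i with
  | zero => exact dvd_mul_left _ _
  | succ i ih => exact dvd_add (ih.trans (dvd_pow_self _ hp)) (dvd_mul_left _ _)

/-- `X ^ (p * p)` divides the `p`-th power in the recursion, so the coefficient of `X ^ p` isolates
`a (i + 1)`; then descend. -/
theorem eq_zero_of_fixedPointPoly_eq_zero (a : ℕ → F) (i : ℕ) (h : fixedPointPoly p a i = 0) :
    ∀ j ≤ i, a j = 0 := by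
  have hp : 2 ≤ p := (Fact.out : p.Prime).two_le
  induction i with
  | zero =>
    intro j hj
    obtain rfl : j = 0 := by omega
    simpa [fixedPointPoly] using h
  | succ i ih =>
    have h0 : a (i + 1) = 0 := by
      obtain ⟨g, hg⟩ := X_pow_dvd_fixedPointPoly (p := p) a i
      have h1 := congrArg (fun f => coeff f p) h
      have h2 : coeff ((X ^ p * g) ^ p) p = 0 := by
        rw [mul_pow, ← pow_mul, coeff_X_pow_mul', if_neg (by nlinarith)]
      simpa [fixedPointPoly, hg, h2] using h1
    have h1 : fixedPointPoly p a i = 0 := by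
      simpa [fixedPointPoly, h0, show p ≠ 0 by omega] using h
    intro j hj
    rcases hj.lt_or_eq with hj | rfl
    · exact ih h1 j (by omega)
    · exact h0

/-- As the polynomial is `X ^ 2 * g`, a nonzero fixed point is a root of `X * g - 1`, which has
positive degree. -/
theorem exists_ne_zero_eval_fixedPointPoly [IsAlgClosed F] (a : ℕ → F) (i : ℕ)
    (h : fixedPointPoly p a i ≠ 0) : ∃ c : F, c ≠ 0 ∧ (fixedPointPoly p a i).eval c = c := by
  have hp : 2 ≤ p := (Fact.out : p.Prime).two_le
  obtain ⟨g, hg⟩ := (pow_dvd_pow X hp).trans (X_pow_dvd_fixedPointPoly (p := p) a i)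
  have hg0 : g ≠ 0 := by
    rintro rfl
    simp [hg] at h
  have hdeg : (X * g - C 1).degree ≠ 0 := by
    have h1 : (C (1 : F)).degree < (X * g).degree := by
      rw [mul_comm, degree_mul_X, degree_C one_ne_zero, degree_eq_natDegree hg0]
      exact_mod_cast Nat.succ_pos _
    rw [degree_sub_eq_left_of_degree_lt h1]
    exact ((zero_le_degree_iff.mpr (C_ne_zero.mpr one_ne_zero)).trans_lt h1).ne'
  obtain ⟨c, hc⟩ := IsAlgClosed.exists_root _ hdeg
  have hc' : c * g.eval c = 1 := by
    simpa [IsRoot, sub_eq_zero] using hc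
  refine ⟨c, ?_, ?_⟩
  · rintro rfl
    simp at hc'
  · rw [hg, eval_mul, eval_pow, eval_X, pow_two, mul_assoc, hc', mul_one]

variable [CharP F p] {V : Type*} [AddCommGroup V] [Module F V]

/-- In finite dimension, some iterate of a self-map at `v` is a combination of the earlier ones. -/
theorem exists_iterate_eq_sum [FiniteDimensional F V]
    (φ : V → V) (v : V) : ∃ n, ∃ a : ℕ → F,
      φ^[n] v = ∑ i ∈ Finset.range n, a i • φ^[i] v := by
  let S : ℕ →o Submodule F V :=
    ⟨fun n => Submodule.span F ((fun i => φ^[i] v) '' (Finset.range n : Set ℕ)), fun m n h =>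
      Submodule.span_mono (Set.image_mono (by simpa using h))⟩
  obtain ⟨n, hn⟩ := monotone_stabilizes_iff_noetherian.mpr
    (inferInstance : IsNoetherian F V) S
  have h : φ^[n] v ∈ S n := by
    rw [hn (n + 1) (by omega)]
    exact Submodule.subset_span ⟨n, by simp, rfl⟩
  obtain ⟨a, ha⟩ := (Submodule.mem_span_image_finset_iff_exists_fun' F).mp h
  refine ⟨n, a, ha.symm⟩

/-- Over an algebraically closed field, a vector is annihilated by a power of a given
Frobenius-semilinear endomorphism, or that endomorphism has a nonzero fixed vector. -/
theorem exists_iterate_eq_zero_or_exists_fixed [IsAlgClosed F] [FiniteDimensional F V]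
    (φ : V →ₛₗ[frobenius F p] V) (v : V) :
    (∃ n, φ^[n] v = 0) ∨ ∃ y, y ≠ 0 ∧ φ y = y := by
  classical
  have hex := exists_iterate_eq_sum (F := F) φ v
  obtain ⟨a, ha⟩ := Nat.find_spec hex
  have hmin := fun m => Nat.find_min hex (m := m)
  generalize Nat.find hex = n at ha hmin
  cases n with
  | zero => exact Or.inl ⟨0, by simpa using ha⟩
  | succ n =>
    by_cases hP : fixedPointPoly p a n = 0
    · refine Or.inl ⟨n + 1, ?_⟩
      rw [ha]
      refine Finset.sum_eq_zero fun i hi => ?_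
      rw [eq_zero_of_fixedPointPoly_eq_zero a n hP i (by simpa [Nat.lt_succ_iff] using hi),
        zero_smul]
    · obtain ⟨c, hc0, hc⟩ := exists_ne_zero_eval_fixedPointPoly a n hP
      refine Or.inr ⟨∑ i ∈ Finset.range (n + 1), (fixedPointPoly p a i).eval c • φ^[i] v, ?_, ?_⟩
      · intro h0
        rw [Finset.sum_range_succ, hc] at h0
        -- The top coefficient is `c ≠ 0`, so a vanishing sum would give a shorter relation, against
        -- minimality.
        refine hmin n (by omega) ⟨fun i => -(c⁻¹ * (fixedPointPoly p a i).eval c), ?_⟩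
        have h1 := congrArg (fun w => c⁻¹ • w) h0
        simp only [smul_add, smul_zero, inv_smul_smul₀ hc0, Finset.smul_sum, smul_smul] at h1
        simp only [neg_smul, Finset.sum_neg_distrib]
        exact eq_neg_of_add_eq_zero_right h1
      · simp only [map_sum, LinearMap.map_smulₛₗ, frobenius_def, ← Function.iterate_succ_apply' φ]
        rw [Finset.sum_range_succ, hc, ha, Finset.smul_sum]
        rw [Finset.sum_range_succ' _ n, ← add_assoc, ← Finset.sum_add_distrib,
          Finset.sum_range_succ' _ n]
        have h1 : ∀ i, (fixedPointPoly p a (i + 1)).eval c =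
            (fixedPointPoly p a i).eval c ^ p + c ^ p * a (i + 1) := fun i => by
          rw [fixedPointPoly, eval_add, eval_pow, eval_mul, eval_C, eval_pow, eval_X, mul_comm]
        have h2 : (fixedPointPoly p a 0).eval c = c ^ p * a 0 := by
          rw [fixedPointPoly, eval_mul, eval_C, eval_pow, eval_X, mul_comm]
        simp only [h1, h2, add_smul, smul_smul]

theorem exists_pow_sub_eq [IsAlgClosed F] (p : ℕ) [Fact p.Prime] [CharP F p] (c : F) :
    ∃ a : F, a ^ p - a = c := by
  have hp : 1 < p := (Fact.out : p.Prime).one_lt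
  have hdeg : (X ^ p - X - C c : F[X]).natDegree = p := by
    rw [natDegree_sub_C]
    exact FiniteField.X_pow_card_sub_X_natDegree_eq F hp
  obtain ⟨a, ha⟩ := IsAlgClosed.exists_root (X ^ p - X - C c : F[X])
    (by
      intro h
      rw [natDegree_eq_of_degree_eq_some (n := 0) (by simpa using h)] at hdeg
      omega)
  exact ⟨a, by simpa [IsRoot, sub_eq_zero] using ha⟩

/-- Over an algebraically closed field, `φ - 1` is surjective for every Frobenius-semilinear
endomorphism `φ` of a finite-dimensional space. -/
theorem exists_semilinear_sub_eq [IsAlgClosed F] [FiniteDimensional F V]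
    (φ : V →ₛₗ[frobenius F p] V) (q : V) : ∃ y, φ y - y = q := by
  induction h : Module.finrank F V using Nat.strong_induction_on generalizing V with
  | _ d ih =>
  rcases exists_iterate_eq_zero_or_exists_fixed φ q with ⟨n, hn⟩ | ⟨v, hv, hφv⟩
  -- The geometric series for `(φ - 1)⁻¹ q` terminates.
  · refine ⟨-∑ i ∈ Finset.range n, φ^[i] q, ?_⟩
    have h1 := Finset.sum_range_succ (fun i => φ^[i] q) n
    rw [Finset.sum_range_succ', hn, add_zero] at h1
    simp only [map_neg, map_sum, ← Function.iterate_succ_apply' φ]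
    rw [← h1]
    simp
  · set W := Submodule.span F {v} with hW
    have hle : W ≤ W.comap φ := by
      rw [hW, Submodule.span_singleton_le_iff_mem]
      simp [hφv, Submodule.mem_span_singleton_self]
    have hlt : Module.finrank F (V ⧸ W) < d := by
      have h1 := W.finrank_quotient_add_finrank
      rw [hW, finrank_span_singleton hv] at h1
      rw [hW]
      omega
    obtain ⟨y', hy'⟩ := ih _ hlt (W.mapQ W φ hle) (W.mkQ q) rfl
    obtain ⟨y, rfl⟩ := W.mkQ_surjective y'
    have h2 : φ y - y - q ∈ W := by
      rw [← Submodule.Quotient.mk_eq_zero]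
      simpa [sub_eq_zero] using hy'
    obtain ⟨c, hc⟩ := Submodule.mem_span_singleton.mp h2
    -- On the fixed line, `φ - 1` is `a ↦ a ^ p - a`; this absorbs the error of the lift.
    obtain ⟨a, ha⟩ := exists_pow_sub_eq (F := F) p (-c)
    refine ⟨y + a • v, ?_⟩
    rw [map_add, LinearMap.map_smulₛₗ, frobenius_def, hφv]
    have h3 : a ^ p • v - a • v = (-c) • v := by rw [← sub_smul, ha]
    rw [neg_smul, hc] at h3
    linear_combination (norm := module) h3

/-- Over an algebraically closed field, some power of a Frobenius-semilinear endomorphism of a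
finite-dimensional space maps a given vector into the span of the fixed vectors. -/
theorem exists_iterate_mem_span_fixed [IsAlgClosed F] [FiniteDimensional F V]
    (φ : V →ₛₗ[frobenius F p] V) (v : V) :
    ∃ n, φ^[n] v ∈ Submodule.span F {y | φ y = y} := by
  set U := Submodule.span F {y | φ y = y} with hU
  have hle : U ≤ U.comap φ := by
    rw [hU, Submodule.span_le]
    intro y hy
    have hy' : φ y = y := hy
    simpa [hy'] using Submodule.subset_span hy
  rcases exists_iterate_eq_zero_or_exists_fixed (U.mapQ U φ hle) (U.mkQ v) with
    ⟨n, hn⟩ | ⟨y', hy0, hy'⟩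
  · refine ⟨n, ?_⟩
    have h1 : ∀ n, (U.mapQ U φ hle)^[n] (U.mkQ v) = U.mkQ (φ^[n] v) := by
      intro n
      induction n with
      | zero => rfl
      | succ n ih => rw [Function.iterate_succ_apply', Function.iterate_succ_apply', ih]; rfl
    rw [h1] at hn
    simpa using hn
  · obtain ⟨y, rfl⟩ := U.mkQ_surjective y'
    have h2 : φ y - y ∈ U := by
      rw [← Submodule.Quotient.mk_eq_zero]
      simpa [sub_eq_zero] using hy'
    let ψ : U →ₛₗ[frobenius F p] U :=
      { toFun := fun u => ⟨φ u, hle u.2⟩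
        map_add' := fun u w => Subtype.ext (by simp)
        map_smul' := fun c u => Subtype.ext (by simp) }
    -- Subtracting `u` turns a vector fixed modulo `U` into a truly fixed one, which lies in `U`;
    -- the quotient has no nonzero fixed vector.
    obtain ⟨u, hu⟩ := exists_semilinear_sub_eq ψ ⟨φ y - y, h2⟩
    have hu' : φ u - u = φ y - y := congrArg Subtype.val hu
    have h3 : y - u ∈ U := Submodule.subset_span (by
      change φ (y - u) = y - u
      rw [map_sub]
      linear_combination (norm := module) -hu')
    refine absurd ?_ hy0
    simpa using U.add_mem h3 u.2

end Semilinear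

/-! ### Computing with the `p`-mapping. -/

namespace RestrictedLieAlgebra

variable {p : ℕ} {F L : Type*} [Field F] [LieRing L] [LieAlgebra F L]

theorem jacobsonCoeff_succ_of_lie_eq_zero {x y : L} (h : ⁅x, y⁆ = 0) (n j : ℕ) :
    jacobsonCoeff x y (n + 1) j = 0 := by
  have h' : ⁅y, x⁆ = 0 := by rw [← lie_skew, h, neg_zero]
  induction n generalizing j with
  | zero => rcases j with _ | _ | j <;> simp [jacobsonCoeff, h']
  | succ n ih =>
    rw [jacobsonCoeff.eq_def]
    cases j <;> simp [ih]

/-- The first bracket gives `-e`, which `ad e` kills; afterwards only `ad t` acts, fixing `-e` and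
raising the exponent. -/
theorem jacobsonCoeff_succ_of_lie_eq_self {t e : L} (h : ⁅t, e⁆ = e) (n j : ℕ) :
    jacobsonCoeff t e (n + 1) j = if j = n then -e else 0 := by
  have h' : ⁅e, t⁆ = -e := by rw [← lie_skew, h]
  induction n generalizing j with
  | zero => rcases j with _ | _ | j <;> simp [jacobsonCoeff, h']
  | succ n ih =>
    rw [jacobsonCoeff.eq_def]
    cases j with
    | zero => simp only [ih]; split_ifs <;> simp_all
    | succ j => simp only [ih, Nat.add_right_cancel_iff]; split_ifs <;> simp_all

theorem pow_apply_of_eigenvector {D : Module.End F L} {f : L} {c : F} (h : D f = c • f) (n : ℕ) :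
    (D ^ n) f = c ^ n • f := by
  induction n with
  | zero => simp
  | succ n ih => rw [pow_succ', Module.End.mul_apply, ih, map_smul, h, smul_smul, pow_succ]

theorem eigenvalue_pow_eq {D : Module.End F L} (hD : D ^ p = D) {f : L} {c : F}
    (h : D f = c • f) (hf : f ≠ 0) : c ^ p = c := by
  have h2 := pow_apply_of_eigenvector h p
  rw [hD, h] at h2
  exact (smul_left_injective F hf h2).symm

variable [RestrictedLieAlgebra p F L]

theorem pMap_lie (x y : L) : ⁅pMap p F x, y⁆ = (LieAlgebra.ad F L x ^ p) y := by
  rw [← ad_pMap, LieAlgebra.ad_apply]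

theorem pMap_lie_of_lie_eq {x y : L} {c : F} (h : ⁅x, y⁆ = c • y) :
    ⁅pMap p F x, y⁆ = c ^ p • y := by
  rw [pMap_lie]
  exact pow_apply_of_eigenvector h p

variable [Fact p.Prime]

theorem pMap_add_of_lie_eq_zero {x y : L} (h : ⁅x, y⁆ = 0) :
    pMap p F (x + y) = pMap p F x + pMap p F y := by
  have hp : 2 ≤ p := (Fact.out : p.Prime).two_le
  rw [pMap_add, add_eq_left]
  refine Finset.sum_eq_zero fun i _ => ?_
  rw [jacobsonS, show p - 1 = (p - 2) + 1 by omega, jacobsonCoeff_succ_of_lie_eq_zero h, smul_zero]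

theorem pMap_add_of_lie_eq_self [CharP F p] {t e : L} (h : ⁅t, e⁆ = e) :
    pMap p F (t + e) = pMap p F t + pMap p F e + e := by
  have hp : 2 ≤ p := (Fact.out : p.Prime).two_le
  rw [pMap_add, add_right_inj, Finset.sum_eq_single (p - 1)]
  -- Only `i = p - 1` survives, and dividing by `p - 1 = -1` in `F` turns `-e` into `e`.
  · rw [jacobsonS, show p - 1 = (p - 2) + 1 by omega, jacobsonCoeff_succ_of_lie_eq_self h,
      if_pos (by omega), show p - 2 + 1 = p - 1 by omega, Nat.cast_sub (by omega)]
    simp [inv_neg]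
  · intro i hi hne
    rw [Finset.mem_Icc] at hi
    rw [jacobsonS, show p - 1 = (p - 2) + 1 by omega, jacobsonCoeff_succ_of_lie_eq_self h,
      if_neg (by omega), smul_zero]
  · intro hne
    exact absurd (Finset.mem_Icc.mpr ⟨by omega, le_rfl⟩) hne

theorem pMap_zero : pMap p F (0 : L) = 0 := by
  have h := pMap_smul (p := p) (0 : F) (0 : L)
  rwa [zero_pow (Fact.out : p.Prime).ne_zero, zero_smul, zero_smul] at h

theorem pMap_lie_eq_zero {x y : L} (h : ⁅x, y⁆ = 0) : ⁅pMap p F x, y⁆ = 0 := by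
  obtain ⟨n, hn⟩ := Nat.exists_eq_succ_of_ne_zero (Fact.out : p.Prime).ne_zero
  have h0 : ⁅pMap p F x, y⁆ = (LieAlgebra.ad F L x ^ p) y := pMap_lie x y
  rw [h0, hn, pow_succ, Module.End.mul_apply, LieAlgebra.ad_apply, h, map_zero]

theorem pMap_lie_pMap (x : L) : ⁅pMap p F x, x⁆ = 0 := pMap_lie_eq_zero (lie_self x)

end RestrictedLieAlgebra

open RestrictedLieAlgebra

/-! ### Restricted lines and semimodularity. -/

namespace RestrictedLieSubalgebra

variable {p : ℕ} {F L : Type*} [Field F] [LieRing L] [LieAlgebra F L]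
  [RestrictedLieAlgebra p F L]

theorem subset_closure (s : Set L) : s ⊆ closure p F s := fun _ hx =>
  mem_sInf.mpr fun _ hS => hS hx

theorem closure_le {s : Set L} {K : RestrictedLieSubalgebra p F L} (h : s ⊆ K) :
    closure p F s ≤ K := fun _ hx => mem_sInf.mp hx K h

theorem lie_mem (K : RestrictedLieSubalgebra p F L) {x y : L} (hx : x ∈ K) (hy : y ∈ K) :
    ⁅x, y⁆ ∈ K := K.lie_mem' hx hy

theorem sub_mem (K : RestrictedLieSubalgebra p F L) {x y : L} (hx : x ∈ K) (hy : y ∈ K) :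
    x - y ∈ K := K.toSubmodule.sub_mem hx hy

theorem smul_mem (K : RestrictedLieSubalgebra p F L) (c : F) {x : L} (hx : x ∈ K) :
    c • x ∈ K := K.toSubmodule.smul_mem c hx

/-- The line through an element whose image under the `p`-mapping is a multiple of it. -/
def line (x : L) (hx : ∃ c : F, pMap p F x = c • x) : RestrictedLieSubalgebra p F L where
  toSubmodule := Submodule.span F {x}
  lie_mem' := by
    intro y z hy hz
    obtain ⟨a, rfl⟩ := Submodule.mem_span_singleton.mp hy
    obtain ⟨b, rfl⟩ := Submodule.mem_span_singleton.mp hz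
    simp
  pMap_mem' := by
    intro y hy
    obtain ⟨a, rfl⟩ := Submodule.mem_span_singleton.mp hy
    obtain ⟨c, hc⟩ := hx
    refine Submodule.mem_span_singleton.mpr ⟨a ^ p * c, ?_⟩
    rw [pMap_smul, hc, smul_smul]

theorem mem_line {x y : L} {hx : ∃ c : F, pMap p F x = c • x} :
    y ∈ line (p := p) x hx ↔ ∃ a : F, a • x = y := Submodule.mem_span_singleton

/-- The restricted subalgebra that normalizes the line through `x`. -/
def lineNormalizer (p : ℕ) (F : Type*) {L : Type*} [Field F] [LieRing L] [LieAlgebra F L]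
    [RestrictedLieAlgebra p F L] (x : L) : RestrictedLieSubalgebra p F L where
  carrier := {z | ∃ c : F, ⁅z, x⁆ = c • x}
  add_mem' := by
    rintro y z ⟨a, ha⟩ ⟨b, hb⟩
    exact ⟨a + b, by rw [add_lie, ha, hb, add_smul]⟩
  zero_mem' := ⟨0, by simp⟩
  smul_mem' := by
    rintro a z ⟨b, hb⟩
    exact ⟨a * b, by rw [smul_lie, hb, smul_smul]⟩
  lie_mem' := by
    rintro y z ⟨a, ha⟩ ⟨b, hb⟩
    refine ⟨0, ?_⟩
    rw [lie_lie, ha, hb, lie_smul, lie_smul, ha, hb, smul_comm, sub_self, zero_smul]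
  pMap_mem' := by
    rintro z ⟨c, hc⟩
    exact ⟨c ^ p, pMap_lie_of_lie_eq hc⟩

/-- The centralizer of an element, as a restricted subalgebra. -/
def centralizer (p : ℕ) [Fact p.Prime] (F : Type*) {L : Type*} [Field F] [LieRing L]
    [LieAlgebra F L] [RestrictedLieAlgebra p F L] (x : L) : RestrictedLieSubalgebra p F L where
  carrier := {z | ⁅z, x⁆ = 0}
  add_mem' := by
    intro y z (hy : ⁅y, x⁆ = 0) (hz : ⁅z, x⁆ = 0)
    change ⁅y + z, x⁆ = 0
    rw [add_lie, hy, hz, add_zero]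
  zero_mem' := zero_lie x
  smul_mem' := by
    intro a z (hz : ⁅z, x⁆ = 0)
    change ⁅a • z, x⁆ = 0
    rw [smul_lie, hz, smul_zero]
  lie_mem' := by
    intro y z (hy : ⁅y, x⁆ = 0) (hz : ⁅z, x⁆ = 0)
    change ⁅⁅y, z⁆, x⁆ = 0
    rw [lie_lie, hy, hz, lie_zero, lie_zero, sub_zero]
  pMap_mem' := fun _ hz => pMap_lie_eq_zero hz

theorem mem_centralizer [Fact p.Prime] {x z : L} : z ∈ centralizer p F x ↔ ⁅z, x⁆ = 0 := Iff.rfl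

/-- If `L` is upper semimodular and `x`, `y` span restricted subalgebras, then the line of `x` is
maximal in the restricted subalgebra generated by `x` and `y`. -/
theorem mem_or_forall_mem_line (hL : RestrictedLieAlgebra.IsUpperSemimodular p F L) {x y : L}
    (hx : ∃ c : F, pMap p F x = c • x) (hy : ∃ c : F, pMap p F y = c • y)
    (K : RestrictedLieSubalgebra p F L) (hxK : x ∈ K) :
    y ∈ K ∨ ∀ z ∈ closure p F {x, y}, z ∈ K → ∃ a : F, a • x = z := by
  have hle : ∀ {x : L} {hx : ∃ c : F, pMap p F x = c • x} {K : RestrictedLieSubalgebra p F L},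
      x ∈ K → line x hx ≤ K := by
    intro x hx K hxK z hz
    obtain ⟨a, rfl⟩ := mem_line.mp hz
    exact K.smul_mem a hxK
  have hself : ∀ {x : L} {hx : ∃ c : F, pMap p F x = c • x}, x ∈ line (p := p) x hx :=
    mem_line.mpr ⟨1, one_smul _ _⟩
  by_cases hyx : ∃ a : F, a • x = y
  · obtain ⟨a, rfl⟩ := hyx
    exact Or.inl (K.smul_mem a hxK)
  have hcov : line x hx ⊓ line y hy ⋖ line y hy := by
    refine ⟨lt_of_le_of_ne (fun z hz => hz.2) fun h => hyx ?_, fun C hC hCy => ?_⟩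
    · have h1 : y ∈ line x hx ⊓ line y hy := by rw [h]; exact hself
      exact mem_line.mp h1.1
    · obtain ⟨z, hzC, hz⟩ := SetLike.exists_of_lt hC
      obtain ⟨a, rfl⟩ := mem_line.mp (hCy.le hzC)
      have ha : a ≠ 0 := by
        rintro rfl
        exact hz (by rw [zero_smul]; exact (line x hx ⊓ line y hy).zero_mem')
      refine hCy.not_ge (hle ?_)
      simpa [smul_smul, ha] using C.smul_mem a⁻¹ hzC
  have hcov' := hL _ _ hcov
  set M := closure p F ((line x hx : Set L) ∪ (line y hy : Set L)) with hM
  have hxM : x ∈ M := subset_closure _ (Or.inl hself)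
  have hyM : y ∈ M := subset_closure _ (Or.inr hself)
  -- `K ⊓ M` lies between the line of `x` and `M`, so it is one of them.
  rcases hcov'.eq_or_eq (c := K ⊓ M) (hle ⟨hxK, hxM⟩) (fun z hz => hz.2) with h | h
  · refine Or.inr fun z hz hzK => ?_
    have h1 : z ∈ K ⊓ M := ⟨hzK, closure_le (by
      rintro w (rfl | rfl)
      · exact hxM
      · exact hyM) hz⟩
    rw [h] at h1
    exact mem_line.mp h1
  · rw [← h] at hyM
    exact Or.inl hyM.1

end RestrictedLieSubalgebra

/-! ### Null elements, toral elements and double centralizers. -/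

namespace RestrictedLieAlgebra

open RestrictedLieSubalgebra

variable {p : ℕ} {F L : Type*} [Field F] [LieRing L] [LieAlgebra F L]
  [RestrictedLieAlgebra p F L]

/-- An element annihilated by the `p`-mapping is an eigenvector of every element that spans a
restricted subalgebra. -/
theorem lie_eq_smul_of_pMap_eq_zero (hL : RestrictedLieAlgebra.IsUpperSemimodular p F L) {x y : L}
    (hx : ∃ c : F, pMap p F x = c • x) (hy : pMap p F y = 0) : ∃ c : F, ⁅x, y⁆ = c • y := by
  rcases mem_or_forall_mem_line hL (x := y) (y := x) ⟨0, by simpa using hy⟩ hx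
    (lineNormalizer p F y) ⟨0, by simp⟩ with h | h
  · exact h
  have hmem : ∀ n, (LieAlgebra.ad F L y ^ n) x ∈ closure p F {y, x} := by
    intro n
    induction n with
    | zero => exact subset_closure _ (by simp)
    | succ n ih =>
      rw [pow_succ', Module.End.mul_apply]
      exact lie_mem _ (subset_closure _ (by simp)) ih
  -- If `(ad y) ^ (n + 1) x` lies in `Fy`, then `(ad y) ^ n x` normalizes `Fy`, so by `h` it lies in
  -- `Fy` too. The descent starts from `(ad y) ^ p = 0`.
  have hind : ∀ n, (∃ a : F, a • y = (LieAlgebra.ad F L y ^ n) x) → ∃ a : F, a • y = x := by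
    intro n
    induction n with
    | zero => exact id
    | succ n ih =>
      rintro ⟨a, ha⟩
      refine ih (h _ (hmem n) ⟨-a, ?_⟩)
      rw [pow_succ', Module.End.mul_apply, LieAlgebra.ad_apply] at ha
      rw [← lie_skew, ← ha, neg_smul]
  obtain ⟨a, rfl⟩ := hind p ⟨0, by rw [← ad_pMap, hy]; simp⟩
  exact ⟨0, by simp⟩

/-- Elements annihilated by the `p`-mapping commute. -/
theorem lie_eq_zero_of_pMap_eq_zero (hL : RestrictedLieAlgebra.IsUpperSemimodular p F L) {x y : L}
    (hx : pMap p F x = 0) (hy : pMap p F y = 0) : ⁅x, y⁆ = 0 := by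
  obtain ⟨c, hc⟩ := lie_eq_smul_of_pMap_eq_zero hL (x := x) ⟨0, by simpa using hx⟩ hy
  have h1 := pMap_lie_of_lie_eq (p := p) hc
  rw [hx, zero_lie, eq_comm, smul_eq_zero] at h1
  rcases h1 with h1 | h1
  · rw [hc, eq_zero_of_pow_eq_zero h1, zero_smul]
  · rw [h1, lie_zero]

variable [Fact p.Prime]

/-- The elements that commute with everything that commutes with `x`. -/
def doubleCentralizer (F : Type*) {L : Type*} [Field F] [LieRing L] [LieAlgebra F L] (x : L) :
    Submodule F L where
  carrier := {y | ∀ z : L, ⁅x, z⁆ = 0 → ⁅y, z⁆ = 0}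
  add_mem' := fun ha hb z hz => by rw [add_lie, ha z hz, hb z hz, add_zero]
  zero_mem' := fun z _ => zero_lie z
  smul_mem' := fun c _ ha z hz => by rw [smul_lie, ha z hz, smul_zero]

theorem self_mem_doubleCentralizer (x : L) : x ∈ doubleCentralizer F x := fun _ h => h

theorem lie_eq_zero_of_mem_doubleCentralizer {x y z : L} (hy : y ∈ doubleCentralizer F x)
    (hz : z ∈ doubleCentralizer F x) : ⁅y, z⁆ = 0 := by
  refine hy z ?_
  rw [← lie_skew, hz x (lie_self x), neg_zero]

/-- The `p`-mapping on a double centralizer, as a Frobenius-semilinear map. -/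
def pMapDoubleCentralizer [CharP F p] (x : L) :
    doubleCentralizer F x →ₛₗ[frobenius F p] doubleCentralizer F x where
  toFun y := ⟨pMap p F (y : L), fun z hz => pMap_lie_eq_zero (y.2 z hz)⟩
  map_add' y z := Subtype.ext
    (pMap_add_of_lie_eq_zero (lie_eq_zero_of_mem_doubleCentralizer y.2 z.2))
  map_smul' c y := Subtype.ext (pMap_smul c (y : L))

variable [CharP F p] [IsAlgClosed F] [FiniteDimensional F L]

theorem exists_pMap_sub_eq (q : L) : ∃ y ∈ doubleCentralizer F q, pMap p F y - y = q := by
  obtain ⟨y, hy⟩ := exists_semilinear_sub_eq (pMapDoubleCentralizer (p := p) (F := F) q)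
    ⟨q, self_mem_doubleCentralizer (F := F) q⟩
  exact ⟨y, y.2, congrArg Subtype.val hy⟩

theorem exists_iterate_pMap_mem_span (x : L) : ∃ n, (pMap p F)^[n] x ∈
    Submodule.span F {y | y ∈ doubleCentralizer F x ∧ pMap p F y = y} := by
  obtain ⟨n, hn⟩ := exists_iterate_mem_span_fixed (pMapDoubleCentralizer (p := p) (F := F) x)
    ⟨x, self_mem_doubleCentralizer (F := F) x⟩
  refine ⟨n, ?_⟩
  have h1 : ∀ n, (((pMapDoubleCentralizer (p := p) (F := F) x)^[n] ⟨x, self_mem_doubleCentralizer (F := F) x⟩ :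
      doubleCentralizer F x) : L) = (pMap p F)^[n] x := by
    intro n
    induction n with
    | zero => rfl
    | succ n ih => rw [Function.iterate_succ_apply', Function.iterate_succ_apply', ← ih]; rfl
  rw [← h1]
  have h2 := Submodule.mem_map_of_mem (f := (doubleCentralizer F x).subtype) hn
  rw [Submodule.map_span] at h2
  refine Submodule.span_mono ?_ h2
  rintro _ ⟨y, hy, rfl⟩
  exact ⟨y.2, congrArg Subtype.val hy⟩

/-- If `t` is toral and `[t, e] = e`, then `e` is annihilated by the `p`-mapping. -/
theorem pMap_eq_zero_of_lie_eq_self (hL : RestrictedLieAlgebra.IsUpperSemimodular p F L) {t e : L}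
    (ht : pMap p F t = t) (he : ⁅t, e⁆ = e) : pMap p F e = 0 := by
  by_cases he0 : e = 0
  · rw [he0, pMap_zero]
  set q := pMap p F e with hq
  have he' : ⁅e, t⁆ = -e := by rw [← lie_skew, he]
  have hqe : ⁅q, e⁆ = 0 := pMap_lie_pMap e
  have hqt : ⁅q, t⁆ = 0 := by
    have hp : 2 ≤ p := (Fact.out : p.Prime).two_le
    rw [hq, pMap_lie, show p = (p - 2) + 1 + 1 by omega, pow_succ, pow_succ,
      Module.End.mul_apply, Module.End.mul_apply, LieAlgebra.ad_apply, LieAlgebra.ad_apply, he']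
    simp
  -- The correction `y` cancels `q` in `(t + e)^[p] = t + q + e`, making `t + e + y` toral.
  obtain ⟨y, hy, hyq⟩ := exists_pMap_sub_eq (p := p) (F := F) (-q)
  have hmem : ∀ z : L, ⁅q, z⁆ = 0 → ⁅y, z⁆ = 0 := fun z hz => hy z (by rw [neg_lie, hz, neg_zero])
  have hyt := hmem t hqt
  have hte : ⁅t + e, y⁆ = 0 := by
    rw [← lie_skew, lie_add, hyt, hmem e hqe, add_zero, neg_zero]
  have hs : pMap p F (t + e + y) = t + e + y := by
    rw [pMap_add_of_lie_eq_zero hte, pMap_add_of_lie_eq_self he, ht, ← hq, eq_add_of_sub_eq hyq]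
    abel
  have hts : ⁅t, t + e + y⁆ = e := by
    rw [lie_add, lie_add, lie_self, he, ← lie_skew, hyt]
    simp
  rcases mem_or_forall_mem_line hL (x := t) (y := t + e + y) ⟨1, by rw [ht, one_smul]⟩
    ⟨1, by rw [hs, one_smul]⟩ (centralizer p F t) (lie_self t) with h | h
  · rw [mem_centralizer, ← lie_skew, hts, neg_eq_zero] at h
    exact absurd h he0
  · have heM : e ∈ closure p F {t, t + e + y} := by
      have h1 := lie_mem (closure p F {t, t + e + y}) (subset_closure _ (by simp : t ∈ _))
        (subset_closure _ (by simp : t + e + y ∈ _))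
      rwa [hts] at h1
    -- Centralizing `t` forces `q = a t`; centralizing `e` then forces `a = 0`.
    obtain ⟨a, ha⟩ := h q ((closure p F {t, t + e + y}).pMap_mem' e heM) hqt
    rw [← ha, smul_lie, he, smul_eq_zero, or_iff_left he0] at hqe
    rw [← ha, hqe, zero_smul]

end RestrictedLieAlgebra

open RestrictedLieSubalgebra

/-! ### Endomorphisms with `D ^ p = D`. -/

section Endomorphism

open Polynomial

variable {F V : Type*} [Field F] [AddCommGroup V] [Module F V] {p : ℕ} [CharP F p]

/-- `X ^ p - X` is separable in characteristic `p`. -/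
theorem isSemisimple_of_pow_char_eq_self {D : Module.End F V} (hD : D ^ p = D) :
    D.IsSemisimple := by
  refine Module.End.isSemisimple_of_squarefree_aeval_eq_zero (p := X ^ p - X)
    (galois_poly_separable p p dvd_rfl).squarefree ?_
  simp [hD]

theorem apply_apply_eq_apply_of_eigenvalues [IsAlgClosed F] [FiniteDimensional F V]
    {D : Module.End F V} (hD : D ^ p = D)
    (h : ∀ (c : F) (f : V), D f = c • f → c = 0 ∨ c = 1 ∨ f = 0) (x : V) : D (D x) = D x := by
  have hx : x ∈ ⨆ μ, D.eigenspace μ := by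
    rw [(isSemisimple_of_pow_char_eq_self hD).iSup_eigenspace_eq_top]
    trivial
  induction hx using Submodule.iSup_induction' with
  | mem c f hf =>
    rw [Module.End.mem_eigenspace_iff] at hf
    rcases h c f hf with rfl | rfl | rfl <;> simp [hf]
  | zero => simp
  | add f g _ _ hf hg => simp [hf, hg]

end Endomorphism

namespace RestrictedLieAlgebra

variable {p : ℕ} {F L : Type*} [Field F]
  [LieRing L] [LieAlgebra F L] [RestrictedLieAlgebra p F L]

theorem ad_pow_of_pMap_eq_self {t : L} (ht : pMap p F t = t) :
    LieAlgebra.ad F L t ^ p = LieAlgebra.ad F L t := by rw [← ad_pMap, ht]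

/-- The eigenvalue satisfies `c ^ p = c`, so rescaling by `c⁻¹` keeps `t` toral and normalizes the
weight to 1. -/
theorem pMap_smul_of_lie_eq_smul {t f : L} {c : F} (ht : pMap p F t = t) (hf : ⁅t, f⁆ = c • f)
    (hf0 : f ≠ 0) (hc : c ≠ 0) :
    pMap p F (c⁻¹ • t) = c⁻¹ • t ∧ ⁅c⁻¹ • t, f⁆ = f := by
  refine ⟨?_, by rw [smul_lie, hf, inv_smul_smul₀ hc]⟩
  rw [pMap_smul, inv_pow, eigenvalue_pow_eq (ad_pow_of_pMap_eq_self ht) hf hf0, ht]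

variable [Fact p.Prime] [CharP F p] [IsAlgClosed F] [FiniteDimensional F L]

/-- If all toral elements are central, then `L` is nilpotent. -/
theorem isNilpotent_of_forall_toral
    (h : ∀ t : L, pMap p F t = t → ∀ e : L, ⁅t, e⁆ = e → e = 0) : LieRing.IsNilpotent L := by
  rw [LieAlgebra.isNilpotent_iff_forall (R := F)]
  intro x
  have hcen : ∀ t : L, pMap p F t = t → LieAlgebra.ad F L t = 0 := by
    intro t ht
    rw [(isSemisimple_of_pow_char_eq_self
      (ad_pow_of_pMap_eq_self ht)).eq_zero_iff_forall_eigenvalue]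
    intro c hc
    by_contra hc0
    obtain ⟨f, hf⟩ := hc.exists_hasEigenvector
    obtain ⟨h1, h2⟩ := pMap_smul_of_lie_eq_smul ht hf.apply_eq_smul hf.2 hc0
    exact hf.2 (h _ h1 f h2)
  obtain ⟨n, hn⟩ := exists_iterate_pMap_mem_span (p := p) (F := F) x
  have hle : Submodule.span F {y | y ∈ doubleCentralizer F x ∧ pMap p F y = y} ≤
      LinearMap.ker (LieAlgebra.ad F L : L →ₗ[F] Module.End F L) :=
    Submodule.span_le.mpr fun y hy => hcen y hy.2
  have h1 : LieAlgebra.ad F L ((pMap p F)^[n] x) = 0 := hle hn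
  have h2 : ∀ n, LieAlgebra.ad F L ((pMap p F)^[n] x) = LieAlgebra.ad F L x ^ p ^ n := by
    intro n
    induction n with
    | zero => simp
    | succ n ih => rw [Function.iterate_succ_apply', ad_pMap, ih, ← pow_mul, pow_succ]
  exact ⟨p ^ n, by rw [← h2, h1]⟩

/-! ### Eigenspaces of a noncentral toral element. -/

section Weights

variable (hL : RestrictedLieAlgebra.IsUpperSemimodular p F L) {t e : L} (ht : pMap p F t = t)
  (he : ⁅t, e⁆ = e) (he0 : e ≠ 0)

include hL ht he he0

/-- Null elements commute, so `e + n` is null as well. Now `e`, `n` and `e + n` are all eigenvectors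
of `ad t`, which forces equal eigenvalues unless `n = 0`. -/
theorem lie_eq_self_of_pMap_eq_zero {n : L} (hn : pMap p F n = 0) : ⁅t, n⁆ = n := by
  have he' := pMap_eq_zero_of_lie_eq_self hL ht he
  have ht' : ∃ c : F, pMap p F t = c • t := ⟨1, by rw [ht, one_smul]⟩
  obtain ⟨c, hc⟩ := lie_eq_smul_of_pMap_eq_zero hL ht' hn
  obtain ⟨d, hd⟩ := lie_eq_smul_of_pMap_eq_zero hL (y := e + n) ht' (by
    rw [pMap_add_of_lie_eq_zero (lie_eq_zero_of_pMap_eq_zero hL he' hn), he', hn, add_zero])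
  rw [lie_add, he, hc] at hd
  have h1 := congrArg (fun w => ⁅t, w⁆) hd
  simp only [lie_add, lie_smul, he, hc] at h1
  have h2 : ((1 - d) * (1 - c)) • e = 0 := by
    linear_combination (norm := module) h1 - c • hd
  rcases smul_eq_zero.mp h2 with h2 | h2
  · rcases mul_eq_zero.mp h2 with h2 | h2
    · obtain rfl : d = 1 := (sub_eq_zero.mp h2).symm
      rw [hc]
      linear_combination (norm := module) hd
    · rw [hc, ← sub_eq_zero.mp h2, one_smul]
  · exact absurd h2 he0

theorem pMap_eq_zero_iff_lie_eq_self {n : L} : pMap p F n = 0 ↔ ⁅t, n⁆ = n :=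
  ⟨lie_eq_self_of_pMap_eq_zero hL ht he he0, pMap_eq_zero_of_lie_eq_self hL ht⟩

/-- An eigenvector `f` of nonzero weight `c` has weight 1 for the toral `c⁻¹ t`, so it is null and
has weight 1 for `t` itself. -/
theorem lie_lie_eq_lie (x : L) : ⁅t, ⁅t, x⁆⁆ = ⁅t, x⁆ := by
  refine apply_apply_eq_apply_of_eigenvalues (ad_pow_of_pMap_eq_self ht) ?_ x
  intro c f hf
  by_contra! h
  obtain ⟨hc, hc1, hf0⟩ := h
  obtain ⟨h1, h2⟩ := pMap_smul_of_lie_eq_smul ht hf hf0 hc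
  have h3 := lie_eq_self_of_pMap_eq_zero hL ht he he0 (pMap_eq_zero_of_lie_eq_self hL h1 h2)
  have h4 : (c - 1) • f = 0 := by
    rw [sub_smul, one_smul, sub_eq_zero, ← (show ⁅t, f⁆ = c • f from hf), h3]
  rcases smul_eq_zero.mp h4 with h4 | h4
  · exact hc1 (sub_eq_zero.mp h4)
  · exact hf0 h4

theorem exists_smul_eq_of_toral {s : L} (hs : pMap p F s = s) (hst : ⁅s, t⁆ = 0) :
    ∃ a : F, a • t = s := by
  have hts : ⁅t, s⁆ = 0 := by rw [← lie_skew, hst, neg_zero]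
  have he' := pMap_eq_zero_of_lie_eq_self hL ht he
  obtain ⟨c, hc⟩ := lie_eq_smul_of_pMap_eq_zero hL (x := s) ⟨1, by rw [hs, one_smul]⟩ he'
  have hcp := eigenvalue_pow_eq (ad_pow_of_pMap_eq_self hs) hc he0
  have hcp' : (1 - c) ^ p = 1 - c := by rw [sub_pow_char, one_pow, hcp]
  -- The shift gives `x` weight 1 on `e`, and it stays toral since `c ^ p = c`. Then `⟨x, t + e⟩_p`
  -- contains `e`, hence `t`, which centralizes `x` and so lies in `Fx`.
  set x := s + (1 - c) • t with hx
  have hxt : ⁅x, t⁆ = 0 := by simp [hx, hst]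
  have hxe : ⁅x, e⁆ = e := by
    rw [hx, add_lie, smul_lie, hc, he]
    module
  have hxp : pMap p F x = x := by
    rw [hx, pMap_add_of_lie_eq_zero (by simp [hst]), pMap_smul, hs, ht, hcp']
  have hyp : pMap p F (t + e) = t + e := by
    rw [pMap_add_of_lie_eq_self he, ht, he', add_zero]
  have hxy : ⁅x, t + e⁆ = e := by rw [lie_add, hxt, hxe, zero_add]
  rcases mem_or_forall_mem_line hL (x := x) (y := t + e) ⟨1, by rw [hxp, one_smul]⟩
    ⟨1, by rw [hyp, one_smul]⟩ (centralizer p F x) (lie_self x) with h | h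
  · rw [mem_centralizer, ← lie_skew, hxy, neg_eq_zero] at h
    exact absurd h he0
  · have hyM : t + e ∈ closure p F {x, t + e} := subset_closure _ (by simp)
    have heM : e ∈ closure p F {x, t + e} := by
      have h1 := lie_mem (closure p F {x, t + e}) (subset_closure _ (by simp : x ∈ _)) hyM
      rwa [hxy] at h1
    have htM : t ∈ closure p F {x, t + e} := by simpa using sub_mem _ hyM heM
    obtain ⟨a, ha⟩ := h t htM (by rw [mem_centralizer, ← lie_skew, hxt, neg_zero])
    have h1 : (a - 1) • e = 0 := by
      have h2 := congrArg (fun w => ⁅w, e⁆) ha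
      simp only [smul_lie, hxe, he] at h2
      rw [sub_smul, h2, one_smul, sub_self]
    rw [smul_eq_zero, or_iff_left he0, sub_eq_zero] at h1
    rw [h1, one_smul] at ha
    exact ⟨c, by linear_combination (norm := module) hx - ha⟩

theorem exists_smul_eq_of_lie_eq_zero {h : L} (hh : ⁅h, t⁆ = 0) : ∃ a : F, a • t = h := by
  obtain ⟨n, hn⟩ := exists_iterate_pMap_mem_span (p := p) (F := F) h
  have hle : Submodule.span F {y | y ∈ doubleCentralizer F h ∧ pMap p F y = y} ≤
      Submodule.span F {t} := by
    refine Submodule.span_le.mpr fun y hy => ?_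
    exact Submodule.mem_span_singleton.mpr
      (exists_smul_eq_of_toral hL ht he he0 hy.2 (hy.1 t hh))
  obtain ⟨a, ha⟩ := Submodule.mem_span_singleton.mp (hle hn)
  clear hn hle
  induction n generalizing h a with
  | zero => exact ⟨a, ha⟩
  | succ n ih =>
    rw [Function.iterate_succ_apply] at ha
    obtain ⟨b, hb⟩ := ih (pMap_lie_eq_zero hh) a ha
    -- With `c ^ p = b`, the element `h - c t` is null, so it has weight 1; it also commutes with
    -- `t`, hence vanishes.
    obtain ⟨c, hc⟩ := IsAlgClosed.exists_pow_nat_eq b (Fact.out : p.Prime).pos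
    have hth : ⁅t, h⁆ = 0 := by rw [← lie_skew, hh, neg_zero]
    have h1 : pMap p F (h + (-c) • t) = 0 := by
      rw [pMap_add_of_lie_eq_zero (by simp [hh]), pMap_smul, ht, ← hb, ← hc,
        show (-c) ^ p = -c ^ p from map_neg (frobenius F p) c]
      module
    have h2 := lie_eq_self_of_pMap_eq_zero hL ht he he0 h1
    rw [lie_add, lie_smul, hth, lie_self, smul_zero, add_zero] at h2
    exact ⟨c, by linear_combination (norm := module) h2⟩

/-- If `L` is upper semimodular and not all toral elements are central, then `L` is almost
abelian. -/
theorem isAlmostAbelian_of_toral : LieAlgebra.IsAlmostAbelian F L := by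
  have hiff := fun {n : L} => pMap_eq_zero_iff_lie_eq_self hL ht he he0 (n := n)
  have hdec : ∀ x : L, ∃ a : F, a • t = x - ⁅t, x⁆ := fun x =>
    exists_smul_eq_of_lie_eq_zero hL ht he he0 (by
      rw [← lie_skew, lie_sub, lie_lie_eq_lie hL ht he he0, sub_self, neg_zero])
  have hcomm : ∀ {a b : L}, ⁅t, a⁆ = a → ⁅t, b⁆ = b → ⁅a, b⁆ = 0 := fun ha hb =>
    lie_eq_zero_of_pMap_eq_zero hL (hiff.mpr ha) (hiff.mpr hb)
  let A : LieIdeal F L :=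
    { carrier := {a | ⁅t, a⁆ = a}
      add_mem' := by
        intro a b (ha : ⁅t, a⁆ = a) (hb : ⁅t, b⁆ = b)
        change ⁅t, a + b⁆ = a + b
        rw [lie_add, ha, hb]
      zero_mem' := lie_zero t
      smul_mem' := by
        intro c a (ha : ⁅t, a⁆ = a)
        change ⁅t, c • a⁆ = c • a
        rw [lie_smul, ha]
      lie_mem := by
        intro x a (ha : ⁅t, a⁆ = a)
        change ⁅t, ⁅x, a⁆⁆ = ⁅x, a⁆
        obtain ⟨c, hc⟩ := hdec x
        have h1 : ⁅x, a⁆ = c • a := by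
          rw [eq_add_of_sub_eq hc.symm, add_lie, smul_lie, ha,
            hcomm (lie_lie_eq_lie hL ht he he0 x) ha, add_zero]
        rw [h1, lie_smul, ha] }
  refine ⟨t, A, ?_, ⟨fun a b => Subtype.ext (hcomm a.2 b.2)⟩, ?_, fun a ha => ha⟩
  · rintro rfl
    exact he0 (by rw [← he, zero_lie])
  · refine IsCompl.of_eq ?_ ?_
    · rw [Submodule.eq_bot_iff]
      rintro x ⟨hx, hxA⟩
      obtain ⟨c, rfl⟩ := Submodule.mem_span_singleton.mp hx
      have h1 : ⁅t, c • t⁆ = c • t := hxA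
      rw [← h1, lie_smul, lie_self, smul_zero]
    · rw [Submodule.eq_top_iff']
      intro x
      obtain ⟨c, hc⟩ := hdec x
      exact Submodule.mem_sup.mpr ⟨c • t, Submodule.mem_span_singleton.mpr ⟨c, rfl⟩, ⁅t, x⁆,
        lie_lie_eq_lie hL ht he he0 x, by rw [hc]; abel⟩

end Weights

end RestrictedLieAlgebra

theorem mainTheorem8 (p : ℕ) [Fact p.Prime] (F : Type*) [Field F] [IsAlgClosed F] [CharP F p]
    (L : Type*) [LieRing L] [LieAlgebra F L] [FiniteDimensional F L]
    [RestrictedLieAlgebra p F L]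
    (hL : RestrictedLieAlgebra.IsUpperSemimodular p F L) :
    LieAlgebra.IsAlmostAbelian F L ∨ LieRing.IsNilpotent L := by
  by_cases h : ∀ t : L, pMap p F t = t → ∀ e : L, ⁅t, e⁆ = e → e = 0
  · exact Or.inr (isNilpotent_of_forall_toral h)
  · push Not at h
    obtain ⟨t, ht, e, he, he0⟩ := h
    exact Or.inl (isAlmostAbelian_of_toral hL ht he he0)
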